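/- A \emph{rack} is a set $X$ with an operation $\triangleright$ such that every left multiplication $\phi_a\colon x\mapsto a\triangleright x$ is a bijection of $X$ satisfying $a\triangleright(b\triangleright c)=(a\triangleright b)\triangleright(a\triangleright c)$. For a finite rack $X$, let $\mathcal{R}(X)$ be the lattice of all subracks of $X$ (including $\emptyset$), ordered by inclusion, with proper part $\overline{\mathcal{R}(X)}=\mathcal{R}(X)\setminus\{\emptyset,X\}$; let $\mathsf{Inf}(\mathcal{R}(X))$ be the subposet of those elements of $\overline{\mathcal{R}(X)}$ that are the meet of a set of coatoms of $\mathcal{R}(X)$; and let $\mathsf{Inn}(X)$ be the group of permutations of $X$ generated by the maps $\phi_a$, $a\in X$. Put $$\mathcal{S}(X)=\{S\in\mathsf{Inf}(\mathcal{R}(X)) : S \text{ is a union of } \mathsf{Inn}(X)\text{-orbits}\},$$ $$\mathcal{P}(X)=\{P\in\mathsf{Inf}(\mathcal{R}(X)) : P\cap S\neq\emptyset \text{ for all } S\in\mathcal{S}(X)\}.$$ The elements of $\mathcal{P}(X)$ are called parabolic subracks. For a finite poset $Q$ let $\Delta(Q)$ be its order complex (the simplicial complex of chains of $Q$), and for a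 finite simplicial complex $\Delta$ let $\tilde\chi(\Delta)=\sum_{i\ge -1}(-1)^i\,\#\{i\text{-simplices of }\Delta\}$ be the reduced Euler characteristic, where the empty set counts as the unique $(-1)$-simplex. \textbf{Theorem.} Let $G$ be a finite group and $p$ a prime dividing $|G|$. Let $|G|_p$ be the order of a Sylow $p$-subgroup of $G$, let $O_p(G)$ be the largest normal $p$-subgroup of $G$, and let $G_p$ be the rack of all elements of $G$ whose order is a power of $p$ (including $1$), with $a\triangleright b=aba^{-1}$. Suppose that for every nontrivial $p$-subgroup $J$ of $G$ the set $\{S\in\mathcal{P}(G_p) : J\subseteq S\}$, whenever it is nonempty, has a unique minimum (that is, a least) element. Then $$\tilde\chi\bigl(\Delta(\overline{\mathcal{R}(G_p)})\bigr)\equiv 0 \pmod{|G|_p}\quad\text{if and only if}\quad O_p(G)\neq G_p.$$ -/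

import Mathlib

/-! ### Order complexes and reduced Euler characteristics -/

/-- The order complex `Δ(P)`: its faces are the nonempty finite chains of `P`. -/
def orderComplex (P : Type*) [PartialOrder P] : AbstractSimplicialComplex P where
  faces := {s | s.Nonempty ∧ IsChain (· ≤ ·) (s : Set P)}
  isRelLowerSet_faces := fun {_} hs =>
    ⟨hs.1, fun _ ht hne => ⟨hne, hs.2.mono (Finset.coe_subset.mpr ht)⟩⟩
  singleton_mem := fun v => ⟨Finset.singleton_nonempty v, by simp⟩

/-- The reduced Euler characteristic `∑_{i ≥ -1} (-1)^i #Δ^i` of a finite simplicial complex.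
A face with `n` vertices has dimension `n - 1`, and `(-1)^(n - 1) = (-1)^(n + 1)`; the summand `-1`
is the contribution of the empty simplex. -/
noncomputable def reducedEulerChar {V : Type*} [Finite V] (K : AbstractSimplicialComplex V) : ℤ :=
  -1 + ∑ᶠ s ∈ K.faces, (-1 : ℤ) ^ (s.card + 1)

/-- The proper part of a bounded poset. -/
def properPart (L : Type*) [PartialOrder L] [BoundedOrder L] : Set L :=
  {x | x ≠ ⊥ ∧ x ≠ ⊤}

/-- `Inf(L)`: the elements of the proper part of `L` that are the meet of a set of coatoms. -/
def infPoset (L : Type*) [CompleteLattice L] : Set L :=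
  {x | x ∈ properPart L ∧ ∃ C : Set L, (∀ c ∈ C, IsCoatom c) ∧ x = sInf C}

/-! ### The lattice of subracks -/

/-- A subrack of a rack `X` (possibly empty). For finite `X`, closure under the inverse operation
is automatic. -/
structure Subrack (X : Type*) [Rack X] where
  carrier : Set X
  act_mem : ∀ {a b : X}, a ∈ carrier → b ∈ carrier → Shelf.act a b ∈ carrier
  invAct_mem : ∀ {a b : X}, a ∈ carrier → b ∈ carrier → Rack.invAct a b ∈ carrier

namespace Subrack

instance instSetLike (X : Type*) [Rack X] : SetLike (Subrack X) X where
  coe S := S.carrier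
  coe_injective S T h := by cases S; cases T; congr

/-- Subracks are ordered by inclusion. -/
instance instPartialOrder (X : Type*) [Rack X] : PartialOrder (Subrack X) :=
  PartialOrder.ofSetLike (Subrack X) X

/-- The meet of a family of subracks is its intersection. -/
instance instInfSet (X : Type*) [Rack X] : InfSet (Subrack X) where
  sInf C :=
    { carrier := {x | ∀ S ∈ C, x ∈ S}
      act_mem := fun ha hb S hS => S.act_mem (ha S hS) (hb S hS)
      invAct_mem := fun ha hb S hS => S.invAct_mem (ha S hS) (hb S hS) }

theorem isGLB_sInf {X : Type*} [Rack X] (C : Set (Subrack X)) : IsGLB C (sInf C) :=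
  ⟨fun S hS _ hx => hx S hS, fun _ hT _ hx _ hS => hT hS hx⟩

/-- The subrack lattice `R(X)`, with greatest element `X` and least element `∅`. -/
instance instCompleteLattice (X : Type*) [Rack X] : CompleteLattice (Subrack X) where
  __ := completeLatticeOfInf (Subrack X) isGLB_sInf
  top := ⟨Set.univ, fun _ _ => trivial, fun _ _ => trivial⟩
  le_top _ _ _ := trivial
  bot := ⟨∅, fun h => h.elim, fun h => h.elim⟩
  bot_le _ _ h := h.elim

instance instFinite (X : Type*) [Rack X] [Finite X] : Finite (Subrack X) :=
  Finite.of_injective (fun S : Subrack X => (S : Set X)) SetLike.coe_injective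

end Subrack

/-- The inner automorphism group of a rack, generated by the left multiplications. -/
def rackInn (X : Type*) [Rack X] : Subgroup (Equiv.Perm X) :=
  Subgroup.closure (Set.range fun a : X => (Rack.act' a : Equiv.Perm X))

/-- The spherical subracks `S(X)`: the elements of `Inf(R(X))` that are unions of
`Inn(X)`-orbits. -/
def sphericalSubracks (X : Type*) [Rack X] : Set (Subrack X) :=
  {S | S ∈ infPoset (Subrack X) ∧
    ∃ T : Set X, (S : Set X) = ⋃ a ∈ T, MulAction.orbit (rackInn X) a}

/-- The parabolic subracks `P(X)`: the elements of `Inf(R(X))` that meet every spherical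
subrack. -/
def parabolicSubracks (X : Type*) [Rack X] : Set (Subrack X) :=
  {A | A ∈ infPoset (Subrack X) ∧ ∀ S ∈ sphericalSubracks X, ((A : Set X) ∩ (S : Set X)).Nonempty}

/-! ### The rack of `p`-power elements of a group -/

/-- The set `G_p` of all elements of `G` whose order is a power of `p`. -/
def pPowerElements (p : ℕ) (G : Type*) [Group G] : Set G :=
  {g | ∃ k : ℕ, orderOf g = p ^ k}

theorem conj_mem_pPowerElements {p : ℕ} {G : Type*} [Group G] (a : G) {b : G}
    (hb : b ∈ pPowerElements p G) : a * b * a⁻¹ ∈ pPowerElements p G := by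
  obtain ⟨k, hk⟩ := hb
  refine ⟨k, ?_⟩
  rw [← hk, ← MulAut.conj_apply]
  exact MulEquiv.orderOf_eq (MulAut.conj a) b

/-- The `p`-power rack `G_p`, with `a ▷ b = a * b * a⁻¹`. -/
instance pPowerRack (p : ℕ) (G : Type*) [Group G] : Rack ↥(pPowerElements p G) where
  act a b := ⟨a.1 * b.1 * a.1⁻¹, conj_mem_pPowerElements a.1 b.2⟩
  self_distrib := by intros; apply Subtype.ext; simp only; group
  invAct a b := ⟨a.1⁻¹ * b.1 * a.1, by
    simpa using conj_mem_pPowerElements (p := p) a.1⁻¹ b.2⟩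
  left_inv := by intro a b; apply Subtype.ext; simp only; group
  right_inv := by intro a b; apply Subtype.ext; simp only; group

/-- The poset of parabolic subracks of `G_p` that contain a given subgroup `J` of `G`. -/
def parabolicSubracksOver (p : ℕ) {G : Type*} [Group G] (J : Subgroup G) :
    Set (Subrack ↥(pPowerElements p G)) :=
  {S | S ∈ parabolicSubracks ↥(pPowerElements p G) ∧
    (J : Set G) ⊆ Subtype.val '' (S : Set ↥(pPowerElements p G))}

/-- The `p`-core `O_p(G)`: the largest normal `p`-subgroup of `G`, as the join of all normal
`p`-subgroups. -/
def pCore (p : ℕ) (G : Type*) [Group G] : Subgroup G :=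
  sSup {N | N.Normal ∧ IsPGroup p N}

/-- In a finite group the join of all normal `p`-subgroups is itself a normal `p`-subgroup. -/
theorem isGreatest_pCore (p : ℕ) [Fact p.Prime] (G : Type*) [Group G] [Finite G] :
    IsGreatest {N : Subgroup G | N.Normal ∧ IsPGroup p N} (pCore p G) := by
  refine ⟨?_, fun N hN => le_sSup hN⟩
  have hs : SupClosed {N : Subgroup G | N.Normal ∧ IsPGroup p N} := by
    rintro A ⟨hA, hA'⟩ B ⟨hB, hB'⟩
    exact ⟨Subgroup.sup_normal A B, hA'.to_sup_of_normal_left hB'⟩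
  exact hs.sSup_mem (Set.toFinite _) ⟨inferInstance, IsPGroup.of_bot⟩ subset_rfl

/-! Call a subrack full if it meets every `Inn`-orbit. Inclusion–exclusion over the sets of orbits
that a subrack may miss shows that, up to sign, the Euler characteristic of the proper part of the
subrack lattice is that of the poset of proper full subracks (`reducedEulerChar_properPart`).

A Sylow subgroup `P` acts on this poset by conjugation. If the fixed points of every nontrivial `J ≤
P` have signed chain count zero, Möbius inversion over the subgroups of `P` leaves only chains with
trivial stabilizer; these fall into free orbits, so `|P|` divides the count
(`card_dvd_chainSum_of_fixed`). On the fixed points of `J`, sending `A` to the meet of the coatoms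
containing `A` and `J` is a closure operator. It never reaches the top, because a proper full `A`
normalized by `J` cannot generate all `p`-elements together with `J` (`exists_coatom`). Its closed
elements are exactly the parabolic subracks over `J`. When `O_p(G) ≠ G_p` these exist, by Sylow's
theorem, so the hypothesis provides a least one, and a poset with a least element has count zero
(`chainSum_fixed_eq_zero`).

If `O_p(G) = G_p`, the rack is a `p`-group. A proper subgroup of a `p`-group misses a conjugacy
class, so the only full subrack is the whole rack and the Euler characteristic is `±1`. -/

/-! ### Signed chain counts -/

section ChainSum

open scoped Classical Pointwise

variable {α : Type*} [PartialOrder α]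

/-- The sum of `(-1) ^ #c` over all chains `c`, including the empty one, of a finite set in a
partial order. -/
noncomputable def chainSum (s : Finset α) : ℤ :=
  ∑ c ∈ s.powerset.filter fun c : Finset α => IsChain (· ≤ ·) (c : Set α), (-1 : ℤ) ^ c.card

theorem chainSum_empty : chainSum (∅ : Finset α) = 1 := by
  simp [chainSum, Finset.filter_singleton]

/-- Nonempty chains are sorted by their greatest element; removing it costs one sign. -/
theorem chainSum_eq_one_sub_sum_lt (s : Finset α) :
    chainSum s = 1 - ∑ x ∈ s, chainSum {y ∈ s | y < x} := by
  have h0 : (∅ : Finset α) ∈ s.powerset.filter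
      (fun c : Finset α => IsChain (· ≤ ·) (c : Set α)) := by simp
  rw [chainSum, ← Finset.add_sum_erase _ _ h0, Finset.card_empty, pow_zero, sub_eq_add_neg,
    ← Finset.sum_neg_distrib]
  congr 1
  simp only [chainSum, ← Finset.sum_neg_distrib]
  rw [Finset.sum_sigma']
  symm
  refine Finset.sum_bij (fun q _ => insert q.1 q.2) ?_ ?_ ?_ ?_
  · rintro ⟨x, c⟩ hq
    simp only [Finset.mem_sigma, Finset.mem_filter, Finset.mem_powerset] at hq
    obtain ⟨hx, hc, hch⟩ := hq
    simp only [Finset.mem_erase, Finset.mem_filter, Finset.mem_powerset]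
    refine ⟨Finset.insert_ne_empty _ _, Finset.insert_subset hx
      (hc.trans (Finset.filter_subset _ _)), ?_⟩
    rw [Finset.coe_insert]
    exact hch.insert fun b hb _ => Or.inr (Finset.mem_filter.1 (hc hb)).2.le
  · rintro ⟨x, c⟩ hq ⟨y, d⟩ hr h
    simp only [Finset.mem_sigma, Finset.mem_filter, Finset.mem_powerset] at hq hr
    have hlt : ∀ z ∈ c, z < x := fun z hz => (Finset.mem_filter.1 (hq.2.1 hz)).2
    have hlt' : ∀ z ∈ d, z < y := fun z hz => (Finset.mem_filter.1 (hr.2.1 hz)).2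
    simp only at h
    have hxy : x = y := by
      have h1 : x ∈ insert y d := h ▸ Finset.mem_insert_self _ _
      have h2 : y ∈ insert x c := h ▸ Finset.mem_insert_self _ _
      rcases Finset.mem_insert.1 h1 with h1 | h1
      · exact h1
      rcases Finset.mem_insert.1 h2 with h2 | h2
      · exact h2.symm
      exact absurd (hlt' _ h1) (hlt _ h2).asymm
    subst hxy
    have hcd : c = d := by
      rw [← Finset.erase_insert (a := x) (s := c) fun hx => (hlt x hx).false, h,
        Finset.erase_insert fun hx => (hlt' x hx).false]
    rw [hcd]
  · intro c hc
    simp only [Finset.mem_erase, Finset.mem_filter, Finset.mem_powerset] at hc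
    obtain ⟨hne, hcs, hch⟩ := hc
    obtain ⟨x, hx⟩ := Finset.exists_maximal (Finset.nonempty_iff_ne_empty.2 hne)
    refine ⟨⟨x, c.erase x⟩, ?_, Finset.insert_erase hx.1⟩
    simp only [Finset.mem_sigma, Finset.mem_filter, Finset.mem_powerset]
    refine ⟨hcs hx.1, fun y hy => Finset.mem_filter.2 ⟨hcs (Finset.mem_of_mem_erase hy), ?_⟩,
      hch.mono (Finset.coe_subset.2 (Finset.erase_subset _ _))⟩
    have hne' := Finset.ne_of_mem_erase hy
    rcases hch (Finset.mem_of_mem_erase hy) hx.1 hne' with h | h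
    · exact lt_of_le_of_ne h hne'
    · exact absurd (hx.eq_of_le (Finset.mem_of_mem_erase hy) h) hne'.symm
  · rintro ⟨x, c⟩ hq
    simp only [Finset.mem_sigma, Finset.mem_filter, Finset.mem_powerset] at hq
    have hx : x ∉ c := fun h => (Finset.mem_filter.1 (hq.2.1 h)).2.false
    simp only [Finset.card_insert_of_notMem hx, pow_succ, mul_neg_one]

theorem chainSum_map_toDual (s : Finset α) :
    chainSum (s.map OrderDual.toDual.toEmbedding) = chainSum s := by
  refine (Finset.sum_bij (fun c _ => c.map OrderDual.toDual.toEmbedding) ?_ ?_ ?_ ?_).symm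
  · intro c hc
    rw [Finset.mem_filter, Finset.mem_powerset] at hc ⊢
    refine ⟨Finset.map_subset_map.2 hc.1, ?_⟩
    rw [Finset.coe_map]
    rintro _ ⟨x, hx, rfl⟩ _ ⟨y, hy, rfl⟩ -
    exact hc.2.total hy hx
  · exact fun c _ d _ h => Finset.map_injective _ h
  · intro c hc
    rw [Finset.mem_filter, Finset.mem_powerset] at hc
    obtain ⟨d, hd, rfl⟩ := Finset.subset_map_iff.1 hc.1
    refine ⟨d, Finset.mem_filter.2 ⟨Finset.mem_powerset.2 hd, fun x hx y hy _ => ?_⟩, rfl⟩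
    exact hc.2.total (Finset.mem_map_of_mem _ hy) (Finset.mem_map_of_mem _ hx)
  · exact fun c _ => by rw [Finset.card_map]

theorem chainSum_eq_one_sub_sum_gt (s : Finset α) :
    chainSum s = 1 - ∑ x ∈ s, chainSum {y ∈ s | x < y} := by
  rw [← chainSum_map_toDual, chainSum_eq_one_sub_sum_lt, Finset.sum_map]
  congr 1
  refine Finset.sum_congr rfl fun x _ => ?_
  rw [← chainSum_map_toDual {y ∈ s | x < y}, Finset.filter_map]
  rfl

/-- The order complex is a cone. In the recursion every `x ≠ a` has `a` as least element strictly
below it and contributes zero by induction; `a` alone contributes `1`. -/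
theorem chainSum_eq_zero_of_isLeast (s : Finset α) {a : α} (ha : IsLeast (s : Set α) a) :
    chainSum s = 0 := by
  induction s using Finset.strongInduction with
  | H s ih =>
    rw [chainSum_eq_one_sub_sum_lt, Finset.sum_eq_single a, sub_eq_zero, eq_comm]
    · convert chainSum_empty (α := α)
      exact Finset.filter_eq_empty_iff.2 fun y hy hya => (ha.2 hy).not_gt hya
    · intro x hx hxa
      refine ih _ (Finset.filter_ssubset.2 ⟨x, hx, lt_irrefl x⟩) ⟨?_, fun y hy => ?_⟩
      · simpa using ⟨ha.1, lt_of_le_of_ne (ha.2 hx) hxa.symm⟩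
      · exact ha.2 (Finset.mem_filter.1 hy).1
    · exact fun h => absurd ha.1 h

/-- By induction each point may be weighted by the closed points strictly above it. Above a
non-closed `x` these have the least element `f x`, so `x` contributes zero. -/
theorem chainSum_eq_of_closure (f : α → α) (hmono : Monotone f) (hle : ∀ x, x ≤ f x)
    (hidem : ∀ x, f (f x) = f x) (s : Finset α) (hs : ∀ x ∈ s, f x ∈ s) :
    chainSum s = chainSum {x ∈ s | f x = x} := by
  induction s using Finset.strongInduction with
  | H s ih =>
    rw [chainSum_eq_one_sub_sum_gt s, chainSum_eq_one_sub_sum_gt, Finset.sum_filter]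
    congr 1
    refine Finset.sum_congr rfl fun x hx => ?_
    rw [ih _ (Finset.filter_ssubset.2 ⟨x, hx, lt_irrefl x⟩) fun y hy => by
      rw [Finset.mem_filter] at hy ⊢
      exact ⟨hs y hy.1, hy.2.trans_le (hle y)⟩]
    rw [Finset.filter_filter, Finset.filter_filter]
    split_ifs with h
    · congr 1
      exact Finset.filter_congr fun y _ => and_comm
    · refine chainSum_eq_zero_of_isLeast (a := f x) _ ⟨?_, fun y hy => ?_⟩
      · simpa using ⟨hs x hx, lt_of_le_of_ne (hle x) (Ne.symm h), hidem x⟩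
      · obtain ⟨-, h1, h2⟩ := by simpa using hy
        exact h2 ▸ hmono h1.le

theorem chainSum_map {β : Type*} [PartialOrder β] (e : β ↪o α) (s : Finset β) :
    chainSum (s.map e.toEmbedding) = chainSum s := by
  induction s using Finset.strongInduction with
  | H s ih =>
    rw [chainSum_eq_one_sub_sum_lt s, chainSum_eq_one_sub_sum_lt, Finset.sum_map]
    congr 1
    refine Finset.sum_congr rfl fun x hx => ?_
    rw [← ih {y ∈ s | y < x} (Finset.filter_ssubset.2 ⟨x, hx, lt_irrefl x⟩), Finset.filter_map]
    congr 2
    exact Finset.filter_congr fun y _ => by simp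

/-- The sign appears because `chainSum` weights a chain by its cardinality, not by its dimension. -/
theorem reducedEulerChar_orderComplex [Fintype α] (P : Set α) :
    reducedEulerChar (orderComplex ↥P) = -chainSum {x : α | x ∈ P} := by
  have hP : chainSum ({x : α | x ∈ P} : Finset α) = chainSum (Finset.univ : Finset P) := by
    rw [← chainSum_map (OrderEmbedding.subtype (· ∈ P))]
    congr 1
    ext x
    simp
  have h0 : (∅ : Finset P) ∈ (Finset.univ : Finset P).powerset.filter
      (fun c : Finset P => IsChain (· ≤ ·) (c : Set P)) := by simp
  rw [hP, reducedEulerChar, finsum_mem_eq_finite_toFinset_sum _ (Set.toFinite _), chainSum,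
    ← Finset.add_sum_erase _ _ h0, neg_add, ← Finset.sum_neg_distrib]
  congr 1
  refine Finset.sum_congr ?_ fun c _ => by rw [pow_succ, mul_neg_one]
  ext c
  simp [orderComplex, Finset.nonempty_iff_ne_empty]

theorem card_dvd_card_of_stabilizer_eq_bot {Q β : Type*} [Group Q] [MulAction Q β] (t : Finset β)
    (ht : ∀ (g : Q), ∀ x ∈ t, g • x ∈ t) (hst : ∀ x ∈ t, MulAction.stabilizer Q x = ⊥) :
    Nat.card Q ∣ t.card := by
  let T : SubMulAction Q β := ⟨t, fun g x hx => ht g x hx⟩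
  have h : ∀ x : T, MulAction.stabilizer Q x = ⊥ := fun x => by
    rw [SubMulAction.stabilizer_of_subMul]
    exact hst x.1 x.2
  have hc : Nat.card T = t.card := by
    exact (Nat.card_eq_fintype_card (α := t)).trans (Fintype.card_coe t)
  rw [← hc, Nat.card_congr (MulAction.selfEquivOrbitsQuotientProd h), Nat.card_prod]
  exact dvd_mul_left _ _

/-- If a finite group acts on a finite partially ordered set and the signed chain count of the fixed
points of every nontrivial subgroup vanishes, then the signed chain count of the whole set is
divisible by the order of the group. -/
theorem card_dvd_chainSum_of_fixed {Q : Type*} [Group Q] [Finite Q] [MulAction Q α]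
    (hmono : ∀ (g : Q) {x y : α}, x ≤ y → g • x ≤ g • y)
    (s : Finset α) (hs : ∀ (g : Q), ∀ x ∈ s, g • x ∈ s)
    (hfix : ∀ J : Subgroup Q, J ≠ ⊥ → chainSum {x ∈ s | ∀ g ∈ J, g • x = x} = 0) :
    (Nat.card Q : ℤ) ∣ chainSum s := by
  let : Fintype (Subgroup Q) := Fintype.ofFinite _
  let : LocallyFiniteOrder (Subgroup Q) := Fintype.toLocallyFiniteOrder
  let C : Finset (Finset α) :=
    s.powerset.filter fun c : Finset α => IsChain (· ≤ ·) (c : Set α)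
  have hC : ∀ c, c ∈ C ↔ c ⊆ s ∧ IsChain (· ≤ ·) (c : Set α) := fun c => by simp [C]
  have hsmulC : ∀ (g : Q), ∀ c ∈ C, g • c ∈ C := by
    intro g c hc
    rw [hC] at hc ⊢
    refine ⟨fun x hx => ?_, ?_⟩
    · obtain ⟨y, hy, rfl⟩ := Finset.mem_smul_finset.1 hx
      exact hs g y (hc.1 hy)
    · rw [Finset.coe_smul_finset]
      rintro _ ⟨x, hx, rfl⟩ _ ⟨y, hy, rfl⟩ -
      exact (hc.2.total hx hy).imp (hmono g) (hmono g)
  -- An automorphism of finite order that preserves a chain fixes it pointwise.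
  have hfixed : ∀ c ∈ C, ∀ J : Subgroup Q,
      J ≤ MulAction.stabilizer Q c ↔ ∀ x ∈ c, ∀ g ∈ J, g • x = x := by
    intro c hc J
    refine ⟨fun h x hx g hg => ?_, fun h g hg => ?_⟩
    · have key : ∀ g ∈ MulAction.stabilizer Q c, ∀ x ∈ c, x ≤ g • x → g • x = x := by
        intro g hg x hx hle
        have hpow : ∀ n : ℕ, g • x ≤ g ^ (n + 1) • x := by
          intro n
          induction n with
          | zero => simp
          | succ n ih =>
            rw [pow_succ, mul_smul]
            have h1 : x ≤ g ^ (n + 1) • x := hle.trans ih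
            refine ih.trans ?_
            exact hmono _ hle
        -- Iterating `x ≤ g • x` up to the power `g ^ |Q| = 1` returns `g • x ≤ x`.
        have h1 := hpow (Nat.card Q - 1)
        rw [Nat.sub_add_cancel Nat.card_pos, pow_card_eq_one', one_smul] at h1
        exact le_antisymm h1 hle
      have hgx : g • x ∈ c := by
        have h1 : g • c = c := h hg
        rw [← h1]
        exact Finset.smul_mem_smul_finset hx
      rcases (hC c).1 hc |>.2.total hx hgx with h1 | h1
      · exact key g (h hg) x hx h1
      · have h2 := hmono g⁻¹ h1
        rw [inv_smul_smul] at h2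
        have h3 := key g⁻¹ (inv_mem (h hg)) x hx h2
        rw [inv_smul_eq_iff] at h3
        exact h3.symm
    · rw [MulAction.mem_stabilizer_iff]
      ext x
      rw [Finset.mem_smul_finset]
      refine ⟨?_, fun hx => ⟨x, hx, h x hx g hg⟩⟩
      rintro ⟨y, hy, rfl⟩
      rwa [h y hy g hg]
  let m : Subgroup Q → ℤ := fun J => IncidenceAlgebra.mu ℤ ⊥ J
  have hm : ∀ K : Subgroup Q, ∑ J with J ≤ K, m J = if ⊥ = K then 1 else 0 := by
    intro K
    rw [← IncidenceAlgebra.sum_Icc_mu_right]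
    refine Finset.sum_congr ?_ fun _ _ => rfl
    ext J
    simp
  -- Weighting the fixed-point counts by the Möbius function `m` of the subgroup lattice counts a
  -- chain once if its stabilizer is trivial and not at all otherwise; by `hfix` only the term of
  -- `⊥` is nonzero.
  have hfree : chainSum s =
      ∑ c ∈ C with MulAction.stabilizer Q c = ⊥, (-1 : ℤ) ^ c.card := by
    have h1 : ∑ J : Subgroup Q, m J * chainSum {x ∈ s | ∀ g ∈ J, g • x = x} = chainSum s := by
      rw [Finset.sum_eq_single ⊥ (fun J _ hJ => by rw [hfix J hJ, mul_zero])
        fun h => absurd (Finset.mem_univ _) h]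
      have h2 : m ⊥ = 1 := IncidenceAlgebra.mu_self _
      rw [h2, one_mul]
      congr 1
      exact Finset.filter_true_of_mem fun x _ g hg => by rw [Subgroup.mem_bot.1 hg, one_smul]
    have h2 : ∀ J : Subgroup Q, chainSum {x ∈ s | ∀ g ∈ J, g • x = x} =
        ∑ c ∈ C, if J ≤ MulAction.stabilizer Q c then (-1 : ℤ) ^ c.card else 0 := by
      intro J
      rw [chainSum, ← Finset.sum_filter]
      refine Finset.sum_congr ?_ fun _ _ => rfl
      ext c
      rw [Finset.mem_filter, Finset.mem_filter, Finset.mem_powerset]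
      constructor
      · rintro ⟨h3, h4⟩
        have hc : c ∈ C := (hC c).2 ⟨h3.trans (Finset.filter_subset _ _), h4⟩
        exact ⟨hc, (hfixed c hc J).2 fun x hx => (Finset.mem_filter.1 (h3 hx)).2⟩
      · rintro ⟨hc, h4⟩
        exact ⟨fun x hx => Finset.mem_filter.2 ⟨((hC c).1 hc).1 hx, (hfixed c hc J).1 h4 x hx⟩,
          ((hC c).1 hc).2⟩
    rw [← h1, Finset.sum_filter]
    simp only [h2, Finset.mul_sum]
    rw [Finset.sum_comm]
    refine Finset.sum_congr rfl fun c _ => ?_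
    simp only [mul_ite, mul_zero]
    rw [← Finset.sum_filter, ← Finset.sum_mul, hm]
    simp only [eq_comm (a := (⊥ : Subgroup Q)), ite_mul, one_mul, zero_mul]
  rw [hfree, ← Finset.sum_fiberwise_of_maps_to (g := Finset.card) (t := Finset.range (s.card + 1))
    fun c hc => Finset.mem_range_succ_iff.2
      (Finset.card_le_card ((hC c).1 (Finset.mem_filter.1 hc).1).1)]
  refine Finset.dvd_sum fun n _ => ?_
  rw [Finset.sum_congr rfl (g := fun _ => (-1 : ℤ) ^ n)
    fun c hc => by rw [(Finset.mem_filter.1 hc).2], Finset.sum_const, nsmul_eq_mul]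
  refine Dvd.dvd.mul_right (Int.natCast_dvd_natCast.2
    (card_dvd_card_of_stabilizer_eq_bot _ (fun g c hc => ?_) fun c hc => ?_)) _
  · simp only [Finset.mem_filter] at hc ⊢
    refine ⟨⟨hsmulC g c hc.1.1, ?_⟩, by rw [Finset.card_smul_finset, hc.2]⟩
    rw [MulAction.stabilizer_smul_eq_stabilizer_map_conj, hc.1.2, Subgroup.map_bot]
  · exact (Finset.mem_filter.1 (Finset.mem_filter.1 hc).1).2

end ChainSum

/-! ### Groups acting on racks by automorphisms -/

/-- A group acts on a rack by rack automorphisms. -/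
class IsRackAction (Γ X : Type*) [Group Γ] [Rack X] [MulAction Γ X] : Prop where
  smul_act : ∀ (g : Γ) (a b : X), g • Shelf.act a b = Shelf.act (g • a) (g • b)

namespace Subrack

variable {X : Type*} [Rack X]

section Action

variable {Γ : Type*} [Group Γ] [MulAction Γ X] [IsRackAction Γ X]

theorem smul_invAct (g : Γ) (a b : X) :
    g • Rack.invAct a b = Rack.invAct (g • a) (g • b) := by
  rw [← Rack.left_cancel (g • a), ← IsRackAction.smul_act, Rack.act_invAct_eq, Rack.act_invAct_eq]

instance instMulAction : MulAction Γ (Subrack X) where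
  smul g A :=
    { carrier := {x | g⁻¹ • x ∈ A}
      act_mem := fun {a b} ha hb => by
        change g⁻¹ • Shelf.act a b ∈ A
        rw [IsRackAction.smul_act]
        exact A.act_mem ha hb
      invAct_mem := fun {a b} ha hb => by
        change g⁻¹ • Rack.invAct a b ∈ A
        rw [smul_invAct]
        exact A.invAct_mem ha hb }
  one_smul A := SetLike.ext fun x => by
    change (1 : Γ)⁻¹ • x ∈ A ↔ x ∈ A
    rw [inv_one, one_smul]
  mul_smul g h A := SetLike.ext fun x => by
    change (g * h)⁻¹ • x ∈ A ↔ h⁻¹ • g⁻¹ • x ∈ A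
    rw [mul_inv_rev, mul_smul]

theorem mem_smul_iff {g : Γ} {A : Subrack X} {x : X} : x ∈ g • A ↔ g⁻¹ • x ∈ A := Iff.rfl

theorem smul_mem_smul_iff {g : Γ} {A : Subrack X} {x : X} : g • x ∈ g • A ↔ x ∈ A := by
  rw [mem_smul_iff, inv_smul_smul]

theorem smul_mono (g : Γ) {A B : Subrack X} (h : A ≤ B) : g • A ≤ g • B := fun _ hx => h hx

theorem smul_top (g : Γ) : g • (⊤ : Subrack X) = ⊤ := rfl

theorem isCoatom_smul (g : Γ) {A : Subrack X} (hA : IsCoatom A) : IsCoatom (g • A) := by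
  refine ⟨fun h => hA.1 ?_, fun B hB => ?_⟩
  · rw [← inv_smul_smul g A, h, smul_top]
  · have h1 : A < g⁻¹ • B := by
      refine lt_of_le_not_ge ?_ fun h => hB.not_ge ?_
      · simpa using smul_mono g⁻¹ hB.le
      · simpa using smul_mono g h
    rw [← smul_inv_smul g B, hA.2 _ h1, smul_top]

end Action

instance rackInn_isRackAction : IsRackAction (rackInn X) X where
  smul_act := by
    rintro ⟨g, hg⟩
    change ∀ a b, g (Shelf.act a b) = Shelf.act (g a) (g b)
    induction hg using Subgroup.closure_induction with
    | mem g hg =>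
      obtain ⟨c, rfl⟩ := hg
      exact fun a b => Shelf.self_distrib
    | one => exact fun _ _ => rfl
    | mul g h _ _ ihg ihh =>
      intro a b
      rw [Equiv.Perm.mul_apply, ihh, ihg]
      rfl
    | inv g _ ih =>
      intro a b
      rw [Equiv.Perm.inv_eq_iff_eq, ih, ← Equiv.Perm.mul_apply, ← Equiv.Perm.mul_apply,
        mul_inv_cancel, Equiv.Perm.one_apply, Equiv.Perm.one_apply]

theorem exists_rackInn_smul_eq_act (a : X) : ∃ g : rackInn X, ∀ b : X, g • b = Shelf.act a b :=
  ⟨⟨Rack.act' a, Subgroup.subset_closure ⟨a, rfl⟩⟩, fun _ => rfl⟩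

theorem exists_rackInn_smul_eq_invAct (a : X) :
    ∃ g : rackInn X, ∀ b : X, g • b = Rack.invAct a b := by
  obtain ⟨g, hg⟩ := exists_rackInn_smul_eq_act a
  refine ⟨g⁻¹, fun b => ?_⟩
  rw [inv_smul_eq_iff, hg, Rack.act_invAct_eq]

theorem smul_mem_orbit_iff {g : rackInn X} {x y : X} :
    g • x ∈ MulAction.orbit (rackInn X) y ↔ x ∈ MulAction.orbit (rackInn X) y := by
  rw [← MulAction.orbit_eq_iff, MulAction.orbit_smul, MulAction.orbit_eq_iff]

/-- The part of a subrack that lies in a set stable under inner automorphisms. -/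
def restrict (A : Subrack X) (T : Set X) (hT : ∀ g : rackInn X, ∀ x ∈ T, g • x ∈ T) :
    Subrack X where
  carrier := {x | x ∈ A ∧ x ∈ T}
  act_mem := fun {a b} ha hb => by
    obtain ⟨g, hg⟩ := exists_rackInn_smul_eq_act a
    exact ⟨A.act_mem ha.1 hb.1, hg b ▸ hT g b hb.2⟩
  invAct_mem := fun {a b} ha hb => by
    obtain ⟨g, hg⟩ := exists_rackInn_smul_eq_invAct a
    exact ⟨A.invAct_mem ha.1 hb.1, hg b ▸ hT g b hb.2⟩

theorem nonempty_of_ne_bot {A : Subrack X} (hA : A ≠ ⊥) : ∃ x, x ∈ A := by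
  by_contra! h
  exact hA (le_bot_iff.1 fun x hx => (h x hx).elim)

theorem exists_notMem_of_ne_top {A : Subrack X} (hA : A ≠ ⊤) : ∃ x, x ∉ A := by
  by_contra! h
  exact hA (top_le_iff.1 fun x _ => h x)

/-- A subrack is full if it meets every orbit of the inner automorphism group. -/
def IsFull (A : Subrack X) : Prop := ∀ x : X, ∃ g : rackInn X, g • x ∈ A

theorem IsFull.mono {A B : Subrack X} (hA : A.IsFull) (h : A ≤ B) : B.IsFull := fun x =>
  (hA x).imp fun _ hg => h hg

theorem IsFull.ne_bot [Nonempty X] {A : Subrack X} (hA : A.IsFull) : A ≠ ⊥ := by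
  rintro rfl
  obtain ⟨g, hg⟩ := hA (Classical.arbitrary X)
  exact hg

/-- A nonempty proper subrack that is stable under inner automorphisms is spherical. -/
theorem mem_sphericalSubracks [Finite X] {A : Subrack X} (hbot : A ≠ ⊥) (htop : A ≠ ⊤)
    (hA : ∀ g : rackInn X, ∀ x ∈ A, g • x ∈ A) : A ∈ sphericalSubracks X := by
  refine ⟨⟨⟨hbot, htop⟩, {M | IsCoatom M ∧ A ≤ M}, fun M hM => hM.1, ?_⟩, A, ?_⟩
  · refine le_antisymm (le_sInf fun M hM => hM.2) fun y hy => ?_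
    by_contra hyA
    -- For `y ∉ A`, a coatom above the complement of the orbit of `y` misses some point of that
    -- orbit. A translate of it misses `y` itself, and still contains the stable subrack `A`, which
    -- is disjoint from the orbit.
    let D : Subrack X := restrict ⊤ (MulAction.orbit (rackInn X) y)ᶜ fun g x hx h =>
      hx (by rwa [smul_mem_orbit_iff] at h)
    have hD : D ≠ ⊤ := fun h => by
      have h1 : y ∈ D := h ▸ trivial
      exact h1.2 (MulAction.mem_orbit_self y)
    obtain ⟨M, hM, hDM⟩ := (eq_top_or_exists_le_coatom D).resolve_left hD
    obtain ⟨z, hz⟩ := exists_notMem_of_ne_top hM.1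
    have hzy : z ∈ MulAction.orbit (rackInn X) y := by
      by_contra h
      exact hz (hDM ⟨trivial, h⟩)
    obtain ⟨g, rfl⟩ := hzy
    have h2 : y ∈ g⁻¹ • M := hy _ ⟨isCoatom_smul g⁻¹ hM, fun x hx => by
      rw [mem_smul_iff, inv_inv]
      refine hDM ⟨trivial, fun h => hyA ?_⟩
      rw [smul_mem_orbit_iff] at h
      obtain ⟨k, hk⟩ := h
      have h3 : k • y = x := hk
      rw [← inv_smul_smul k y, h3]
      exact hA _ _ hx⟩
    rw [mem_smul_iff, inv_inv] at h2
    exact hz h2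
  · ext x
    simp only [Set.mem_iUnion]
    constructor
    · exact fun hx => ⟨x, hx, MulAction.mem_orbit_self x⟩
    · rintro ⟨a, ha, g, rfl⟩
      exact hA g a ha

/-- Since no orbit is everything, each single orbit is spherical, and every spherical subrack
contains an orbit. -/
theorem mem_parabolicSubracks_iff [Finite X]
    (hX : ∀ x : X, MulAction.orbit (rackInn X) x ≠ Set.univ) {A : Subrack X} :
    A ∈ parabolicSubracks X ↔ A ∈ infPoset (Subrack X) ∧ A.IsFull := by
  refine and_congr_right fun _ => ⟨fun h x => ?_, fun h S hS => ?_⟩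
  · let O : Subrack X := restrict ⊤ (MulAction.orbit (rackInn X) x) fun g y hy => by
      rwa [smul_mem_orbit_iff]
    have hxO : x ∈ O := ⟨trivial, MulAction.mem_orbit_self x⟩
    have hO : O ∈ sphericalSubracks X := by
      refine mem_sphericalSubracks (fun h => ?_) (fun h => hX x ?_) fun g y hy => ⟨trivial, ?_⟩
      · rw [h] at hxO
        exact hxO
      · refine Set.eq_univ_of_forall fun y => ?_
        have hy : y ∈ O := h ▸ trivial
        exact hy.2
      · rw [smul_mem_orbit_iff]
        exact hy.2
    obtain ⟨y, hyA, hyO⟩ := h O hO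
    obtain ⟨g, rfl⟩ := hyO.2
    exact ⟨g, hyA⟩
  · obtain ⟨⟨⟨hbot, -⟩, -⟩, T, hT⟩ := hS
    obtain ⟨x, hx⟩ := nonempty_of_ne_bot hbot
    obtain ⟨g, hg⟩ := h x
    refine ⟨g • x, hg, ?_⟩
    have hx' : x ∈ (S : Set X) := hx
    rw [hT] at hx' ⊢
    simp only [Set.mem_iUnion] at hx' ⊢
    obtain ⟨a, ha, hxa⟩ := hx'
    exact ⟨a, ha, by rwa [smul_mem_orbit_iff]⟩

/-! ### Reduction to full subracks by inclusion–exclusion over orbits -/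

section Euler

open scoped Classical

variable [Fintype (Subrack X)]

/-- The summand is `-μ(⊥, B)`, so this is the defining relation of the Möbius function. -/
theorem sum_chainSum_Ioc (A : Subrack X) :
    (∑ B : Subrack X with ⊥ < B ∧ B ≤ A, chainSum {C : Subrack X | ⊥ < C ∧ C < B}) =
      if A = ⊥ then 0 else 1 := by
  split_ifs with hA
  · refine Finset.sum_eq_zero fun B hB => ?_
    rw [Finset.mem_filter, hA] at hB
    exact absurd hB.2.1 hB.2.2.not_gt
  · have h1 : ({B : Subrack X | ⊥ < B ∧ B ≤ A} : Finset (Subrack X)) =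
        insert A ({B : Subrack X | ⊥ < B ∧ B < A} : Finset (Subrack X)) := by
      ext B
      simp only [Finset.mem_filter, Finset.mem_univ, true_and, Finset.mem_insert, le_iff_lt_or_eq]
      constructor
      · rintro ⟨h, h' | h'⟩
        · exact Or.inr ⟨h, h'⟩
        · exact Or.inl h'
      · rintro (rfl | ⟨h, h'⟩)
        · exact ⟨bot_lt_iff_ne_bot.2 hA, Or.inr rfl⟩
        · exact ⟨h, Or.inl h'⟩
    rw [h1, Finset.sum_insert (by simp), chainSum_eq_one_sub_sum_lt, sub_add_eq_add_sub,
      sub_eq_iff_eq_add]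
    congr 1
    refine Finset.sum_congr rfl fun B hB => ?_
    rw [Finset.filter_filter]
    congr 1
    refine Finset.filter_congr fun C _ => ?_
    have hBA := (Finset.mem_filter.1 hB).2.2
    exact ⟨fun h => ⟨⟨h.1, h.2.trans hBA⟩, h.2⟩, fun h => ⟨h.1.1, h.2⟩⟩

variable [Fintype (MulAction.orbitRel.Quotient (rackInn X) X)]

/-- Fullness is expanded over the sets `T` of orbits that are missed. The subracks of `A` missing
`T` are those below `D T`, so the inner sum is `1` unless `D T = ⊥`, which for full `A` means that
`T` consists of all orbits. As the full alternating sum vanishes, minus that one term remains. -/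
theorem sum_chainSum_isFull [Nonempty X] {A : Subrack X} (hA : A.IsFull) :
    (∑ B : Subrack X with B.IsFull ∧ B ≤ A, chainSum {C : Subrack X | ⊥ < C ∧ C < B}) =
      -(-1) ^ Fintype.card (MulAction.orbitRel.Quotient (rackInn X) X) := by
  let Ω := MulAction.orbitRel.Quotient (rackInn X) X
  let π : X → Ω := Quotient.mk''
  have hπ : ∀ (g : rackInn X) (x : X), π (g • x) = π x := fun g x =>
    Quotient.sound (MulAction.mem_orbit x g)
  have hπ' : ∀ x y : X, π y = π x → ∃ g : rackInn X, g • x = y := fun x y h => Quotient.exact h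
  have hfull : ∀ B : Subrack X, B.IsFull ↔ ∀ ω : Ω, ∃ x ∈ B, π x = ω := by
    intro B
    constructor
    · intro h ω
      obtain ⟨x, rfl⟩ := Quotient.exists_rep ω
      obtain ⟨g, hg⟩ := h x
      exact ⟨_, hg, hπ g x⟩
    · intro h x
      obtain ⟨y, hy, hyx⟩ := h (π x)
      obtain ⟨g, rfl⟩ := hπ' x y hyx
      exact ⟨g, hy⟩
  have hΩ : Nonempty Ω := ⟨π (Classical.arbitrary X)⟩
  have hind : ∀ B : Subrack X, (if B.IsFull then (1 : ℤ) else 0) =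
      ∑ T : Finset Ω, if ∀ x ∈ B, π x ∉ T then (-1 : ℤ) ^ T.card else 0 := by
    intro B
    let N : Finset Ω := {ω | ∀ x ∈ B, π x ≠ ω}
    have h1 : ({T : Finset Ω | ∀ x ∈ B, π x ∉ T} : Finset (Finset Ω)) = N.powerset := by
      ext T
      simp only [Finset.mem_filter, Finset.mem_univ, true_and, Finset.mem_powerset]
      constructor
      · intro h ω hω
        simp only [N, Finset.mem_filter, Finset.mem_univ, true_and]
        rintro x hx rfl
        exact h x hx hω
      · intro h x hx hT
        exact (Finset.mem_filter.1 (h hT)).2 x hx rfl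
    rw [← Finset.sum_filter, h1, Finset.sum_powerset_neg_one_pow_card]
    refine if_congr ?_ rfl rfl
    rw [hfull, Finset.filter_eq_empty_iff]
    simp
  let D : Finset Ω → Subrack X := fun T => A.restrict {x | π x ∉ T} fun g x hx => by
    rw [Set.mem_ofPred_eq, hπ]
    exact hx
  have hD : ∀ T, D T = ⊥ ↔ T = Finset.univ := by
    intro T
    constructor
    · intro h
      refine Finset.eq_univ_of_forall fun ω => ?_
      obtain ⟨x, hx, rfl⟩ := (hfull A).1 hA ω
      by_contra hT
      have hxD : x ∈ D T := ⟨hx, hT⟩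
      rw [h] at hxD
      exact hxD
    · rintro rfl
      exact le_bot_iff.1 fun x hx => (hx.2 (Finset.mem_univ _)).elim
  calc
    _ = ∑ B : Subrack X with ⊥ < B ∧ B ≤ A, (if B.IsFull then (1 : ℤ) else 0) *
          chainSum {C : Subrack X | ⊥ < C ∧ C < B} := by
        simp only [ite_mul, one_mul, zero_mul]
        rw [← Finset.sum_filter, Finset.filter_filter]
        refine Finset.sum_congr (Finset.filter_congr fun B _ => ?_) fun _ _ => rfl
        exact ⟨fun h => ⟨⟨bot_lt_iff_ne_bot.2 h.1.ne_bot, h.2⟩, h.1⟩, fun h => ⟨h.2, h.1.2⟩⟩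
    _ = ∑ T : Finset Ω, (-1) ^ T.card * ∑ B : Subrack X with ⊥ < B ∧ B ≤ D T,
          chainSum {C : Subrack X | ⊥ < C ∧ C < B} := by
        simp only [hind, Finset.sum_mul]
        rw [Finset.sum_comm]
        refine Finset.sum_congr rfl fun T _ => ?_
        simp only [ite_mul, zero_mul]
        rw [← Finset.sum_filter, Finset.filter_filter, Finset.mul_sum]
        refine Finset.sum_congr (Finset.filter_congr fun B _ => ?_) fun _ _ => rfl
        exact ⟨fun h => ⟨h.1.1, fun x hx => ⟨h.1.2 hx, h.2 x hx⟩⟩,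
          fun h => ⟨⟨h.1, fun x hx => (h.2 hx).1⟩, fun x hx => (h.2 hx).2⟩⟩
    _ = ∑ T : Finset Ω, ((-1) ^ T.card - if T = Finset.univ then (-1) ^ T.card else 0) := by
        refine Finset.sum_congr rfl fun T _ => ?_
        rw [sum_chainSum_Ioc]
        simp only [hD]
        split_ifs <;> simp
    _ = _ := by
        rw [Finset.sum_sub_distrib, ← Finset.powerset_univ, Finset.sum_powerset_neg_one_pow_card,
          if_neg Finset.univ_nonempty.ne_empty, Finset.powerset_univ, Finset.sum_ite_eq',
          if_pos (Finset.mem_univ _), zero_sub, Finset.card_univ]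

/-- By `sum_chainSum_isFull`, the left side satisfies the recursion over full subracks below `A`
that defines the right side. -/
theorem chainSum_Ioo_eq [Nonempty X] (A : Subrack X) (hA : A.IsFull) :
    chainSum {C : Subrack X | ⊥ < C ∧ C < A} =
      -(-1) ^ Fintype.card (MulAction.orbitRel.Quotient (rackInn X) X) *
        chainSum {C : Subrack X | C.IsFull ∧ C < A} := by
  induction A using WellFoundedLT.induction with
  | _ A ih =>
    have h1 : ({B : Subrack X | B.IsFull ∧ B ≤ A} : Finset (Subrack X)) =
        insert A ({B : Subrack X | B.IsFull ∧ B < A} : Finset (Subrack X)) := by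
      ext B
      simp only [Finset.mem_filter, Finset.mem_univ, true_and, Finset.mem_insert, le_iff_lt_or_eq]
      constructor
      · rintro ⟨h, h' | h'⟩
        · exact Or.inr ⟨h, h'⟩
        · exact Or.inl h'
      · rintro (rfl | ⟨h, h'⟩)
        · exact ⟨hA, Or.inr rfl⟩
        · exact ⟨h, Or.inl h'⟩
    have h2 := sum_chainSum_isFull hA
    rw [h1, Finset.sum_insert (by simp)] at h2
    rw [eq_sub_of_add_eq h2, chainSum_eq_one_sub_sum_lt {C : Subrack X | C.IsFull ∧ C < A},
      mul_sub, mul_one, Finset.mul_sum]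
    congr 1
    refine Finset.sum_congr rfl fun B hB => ?_
    rw [Finset.mem_filter] at hB
    rw [ih B hB.2.2 hB.2.1, Finset.filter_filter]
    congr 2
    exact Finset.filter_congr fun C _ =>
      ⟨fun h => ⟨⟨h.1, h.2.trans hB.2.2⟩, h.2⟩, fun h => ⟨h.1.1, h.2⟩⟩

/-- The reduced Euler characteristic of the subrack lattice is, up to sign, that of the poset of
proper full subracks. -/
theorem reducedEulerChar_properPart [Nonempty X] :
    reducedEulerChar (orderComplex ↥(properPart (Subrack X))) =
      (-1) ^ Fintype.card (MulAction.orbitRel.Quotient (rackInn X) X) *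
        chainSum {A : Subrack X | A.IsFull ∧ A ≠ ⊤} := by
  have htop : (⊤ : Subrack X).IsFull := fun x => ⟨1, trivial⟩
  have h := chainSum_Ioo_eq (⊤ : Subrack X) htop
  simp only [bot_lt_iff_ne_bot, lt_top_iff_ne_top] at h
  rw [reducedEulerChar_orderComplex]
  have hP : ({A | A ∈ properPart (Subrack X)} : Finset (Subrack X)) =
      ({A | A ≠ ⊥ ∧ A ≠ ⊤} : Finset (Subrack X)) := by
    ext A
    rw [Finset.mem_filter, Finset.mem_filter]
    rfl
  rw [hP, h, neg_mul, neg_neg]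

end Euler

end Subrack

/-! ### The action of a group on its `p`-power rack -/

section PPower

variable {p : ℕ} {G : Type*} [Group G]

theorem mem_pPowerElements_of_isPGroup [Fact p.Prime] {J : Subgroup G} (hJ : IsPGroup p J) {x : G}
    (hx : x ∈ J) : x ∈ pPowerElements p G := by
  obtain ⟨k, hk⟩ := IsPGroup.iff_orderOf.1 hJ ⟨x, hx⟩
  exact ⟨k, by rwa [Subgroup.orderOf_mk] at hk⟩

theorem isPGroup_zpowers_of_mem_pPowerElements {x : G} (hx : x ∈ pPowerElements p G) :
    IsPGroup p (Subgroup.zpowers x) := by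
  obtain ⟨k, hk⟩ := hx
  exact IsPGroup.of_card (n := k) (by rw [Nat.card_zpowers, hk])

namespace pPowerRack

/-- Conjugation on the `p`-power rack. -/
instance instMulAction : MulAction G ↥(pPowerElements p G) where
  smul g a := ⟨g * a.1 * g⁻¹, conj_mem_pPowerElements g a.2⟩
  one_smul a := Subtype.ext (by change 1 * a.1 * 1⁻¹ = a.1; group)
  mul_smul g h a := Subtype.ext (by
    change g * h * a.1 * (g * h)⁻¹ = g * (h * a.1 * h⁻¹) * g⁻¹; group)

theorem coe_smul (g : G) (a : ↥(pPowerElements p G)) : (g • a).1 = g * a.1 * g⁻¹ := rfl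

theorem act_eq_smul (a b : ↥(pPowerElements p G)) : Shelf.act a b = a.1 • b := rfl

theorem invAct_eq_smul (a b : ↥(pPowerElements p G)) : Rack.invAct a b = a.1⁻¹ • b :=
  Subtype.ext (by rw [coe_smul, inv_inv]; rfl)

instance instIsRackAction : IsRackAction G ↥(pPowerElements p G) where
  smul_act g a b := by
    rw [act_eq_smul, act_eq_smul, coe_smul, smul_smul, smul_smul, inv_mul_cancel_right]

/-- The elements of `p`-power order of a subgroup, as a subrack. -/
def ofSubgroup (p : ℕ) (K : Subgroup G) : Subrack ↥(pPowerElements p G) where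
  carrier := {x | x.1 ∈ K}
  act_mem ha hb := K.mul_mem (K.mul_mem ha hb) (K.inv_mem ha)
  invAct_mem ha hb := K.mul_mem (K.mul_mem (K.inv_mem ha) hb) ha

/-- The subgroup generated by a subrack. -/
def groupClosure (A : Subrack ↥(pPowerElements p G)) : Subgroup G :=
  Subgroup.closure (Subtype.val '' (A : Set ↥(pPowerElements p G)))

theorem mem_groupClosure {A : Subrack ↥(pPowerElements p G)} {x : ↥(pPowerElements p G)}
    (hx : x ∈ A) : x.1 ∈ groupClosure A := Subgroup.subset_closure ⟨x, hx, rfl⟩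

theorem smul_mem_of_mem_groupClosure {A : Subrack ↥(pPowerElements p G)} {g : G}
    (hg : g ∈ groupClosure A) {x : ↥(pPowerElements p G)} (hx : x ∈ A) : g • x ∈ A := by
  induction hg using Subgroup.closure_induction'' generalizing x with
  | one => rwa [one_smul]
  | mem g hg =>
    obtain ⟨a, ha, rfl⟩ := hg
    exact act_eq_smul a x ▸ A.act_mem ha hx
  | inv_mem g hg =>
    obtain ⟨a, ha, rfl⟩ := hg
    exact invAct_eq_smul a x ▸ A.invAct_mem ha hx
  | mul g h _ _ ihg ihh =>
    rw [mul_smul]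
    exact ihg (ihh hx)

/-- The subgroup generated by the elements of `p`-power order. -/
def pResidual (p : ℕ) (G : Type*) [Group G] : Subgroup G := Subgroup.closure (pPowerElements p G)

/-- With `exists_rackInn`, this identifies the `Inn`-orbits with the orbits under conjugation by
`pResidual p G`, which may be smaller than conjugacy classes of `G`. -/
theorem exists_mem_pResidual (g : rackInn ↥(pPowerElements p G)) :
    ∃ h ∈ pResidual p G, ∀ x : ↥(pPowerElements p G), g • x = h • x := by
  obtain ⟨g, hg⟩ := g
  change ∃ h ∈ pResidual p G, ∀ x : ↥(pPowerElements p G), g x = h • x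
  induction hg using Subgroup.closure_induction with
  | mem g hg =>
    obtain ⟨a, rfl⟩ := hg
    exact ⟨a.1, Subgroup.subset_closure a.2, fun x => act_eq_smul a x⟩
  | one => exact ⟨1, one_mem _, fun x => (one_smul _ _).symm⟩
  | mul g h _ _ ihg ihh =>
    obtain ⟨a, ha, ha'⟩ := ihg
    obtain ⟨b, hb, hb'⟩ := ihh
    exact ⟨a * b, mul_mem ha hb, fun x => by rw [Equiv.Perm.mul_apply, hb', ha', mul_smul]⟩
  | inv g _ ih =>
    obtain ⟨a, ha, ha'⟩ := ih
    exact ⟨a⁻¹, inv_mem ha, fun x => by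
      rw [Equiv.Perm.inv_eq_iff_eq, ha', smul_inv_smul]⟩

theorem exists_rackInn {h : G} (hh : h ∈ pResidual p G) :
    ∃ g : rackInn ↥(pPowerElements p G), ∀ x : ↥(pPowerElements p G), g • x = h • x := by
  induction hh using Subgroup.closure_induction with
  | mem a ha => exact Subrack.exists_rackInn_smul_eq_act (⟨a, ha⟩ : ↥(pPowerElements p G))
  | one => exact ⟨1, fun x => by rw [one_smul, one_smul]⟩
  | mul a b _ _ iha ihb =>
    obtain ⟨g, hg⟩ := iha
    obtain ⟨k, hk⟩ := ihb
    exact ⟨g * k, fun x => by rw [mul_smul, hk, hg, mul_smul]⟩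
  | inv a _ ih =>
    obtain ⟨g, hg⟩ := ih
    exact ⟨g⁻¹, fun x => by rw [inv_smul_eq_iff, hg, smul_inv_smul]⟩

theorem isFull_iff {A : Subrack ↥(pPowerElements p G)} :
    A.IsFull ↔ ∀ x : ↥(pPowerElements p G), ∃ h ∈ pResidual p G, h • x ∈ A := by
  refine forall_congr' fun x => ⟨?_, ?_⟩
  · rintro ⟨g, hg⟩
    obtain ⟨h, hh, hgh⟩ := exists_mem_pResidual g
    exact ⟨h, hh, hgh x ▸ hg⟩
  · rintro ⟨h, hh, hx⟩
    obtain ⟨g, hg⟩ := exists_rackInn hh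
    exact ⟨g, (hg x).symm ▸ hx⟩

/-- `pResidual p G` is normal in `G`, so `G` permutes its orbits. -/
theorem isFull_smul (g : G) {A : Subrack ↥(pPowerElements p G)} (hA : A.IsFull) :
    (g • A).IsFull := by
  have hnormal : ∀ h ∈ pResidual p G, g * h * g⁻¹ ∈ pResidual p G := by
    intro h hh
    induction hh using Subgroup.closure_induction with
    | mem a ha => exact Subgroup.subset_closure (conj_mem_pPowerElements g ha)
    | one => simp
    | mul a b _ _ iha ihb => simpa [mul_assoc] using mul_mem iha ihb
    | inv a _ ih => simpa [mul_assoc] using inv_mem ih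
  rw [isFull_iff] at hA ⊢
  intro x
  obtain ⟨h, hh, hx⟩ := hA (g⁻¹ • x)
  refine ⟨_, hnormal h hh, ?_⟩
  rwa [Subrack.mem_smul_iff, smul_smul, mul_assoc, inv_mul_cancel_left, mul_smul]

/-- A subrack is stable under conjugation by the group it generates; here it is therefore a union of
orbits, and it meets all of them. -/
theorem eq_top_of_isFull {A : Subrack ↥(pPowerElements p G)} (hA : A.IsFull)
    (h : pResidual p G ≤ groupClosure A) : A = ⊤ := by
  refine top_le_iff.1 fun x _ => ?_
  obtain ⟨k, hk, hx⟩ := isFull_iff.1 hA x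
  rw [← inv_smul_smul k x]
  exact smul_mem_of_mem_groupClosure (inv_mem (h hk)) hx

/-- A full subrack that generates, together with a group normalizing it, all elements of `p`-power
order is the whole rack. -/
theorem eq_top_of_isFull_of_le_sup {A : Subrack ↥(pPowerElements p G)} (hA : A.IsFull)
    {J : Subgroup G} (hJ : ∀ g ∈ J, g • A = A) (h : pResidual p G ≤ groupClosure A ⊔ J) :
    A = ⊤ := by
  have hstab : ∀ g ∈ groupClosure A ⊔ J, ∀ x ∈ A, g • x ∈ A := by
    have hle : groupClosure A ⊔ J ≤ MulAction.stabilizer G A := by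
      refine sup_le (fun g hg => ?_) fun g hg => hJ g hg
      rw [MulAction.mem_stabilizer_iff]
      refine SetLike.ext fun x => ?_
      rw [Subrack.mem_smul_iff]
      refine ⟨fun hx => ?_, fun hx => smul_mem_of_mem_groupClosure (inv_mem hg) hx⟩
      simpa using smul_mem_of_mem_groupClosure hg hx
    intro g hg x hx
    have h1 : g • A = A := hle hg
    rw [← h1]
    exact Subrack.smul_mem_smul_iff.2 hx
  refine top_le_iff.1 fun x _ => ?_
  obtain ⟨k, hk, hx⟩ := isFull_iff.1 hA x
  rw [← inv_smul_smul k x]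
  exact hstab _ (inv_mem (h hk)) _ hx

theorem exists_coatom {A : Subrack ↥(pPowerElements p G)} [Finite G] (hA : A.IsFull) (hA' : A ≠ ⊤)
    {J : Subgroup G} (hJ : ∀ g ∈ J, g • A = A) :
    ∃ M : Subrack ↥(pPowerElements p G), IsCoatom M ∧ A ≤ M ∧ ∀ x, x.1 ∈ J → x ∈ M := by
  have h : ofSubgroup p (groupClosure A ⊔ J) ≠ ⊤ := by
    intro h
    refine hA' (eq_top_of_isFull_of_le_sup hA hJ ((Subgroup.closure_le _).2 fun x hx => ?_))
    have h1 : (⟨x, hx⟩ : ↥(pPowerElements p G)) ∈ ofSubgroup p (groupClosure A ⊔ J) :=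
      h ▸ trivial
    exact h1
  obtain ⟨M, hM, hle⟩ := (eq_top_or_exists_le_coatom _).resolve_left h
  exact ⟨M, hM, fun x hx => hle (Subgroup.mem_sup_left (mem_groupClosure hx)),
    fun x hx => hle (Subgroup.mem_sup_right hx)⟩

end pPowerRack

end PPower

/-! ### Sylow subgroups, fixed points and parabolic subracks -/

namespace pPowerRack

variable {p : ℕ} {G : Type*} [Group G] [Finite G]

/-- In a nilpotent group maximal subgroups are normal. One that contains the group generated by `A`
meets every class of `p`-elements, hence contains them all and is not proper. -/
theorem eq_top_of_isFull_of_isPGroup [Fact p.Prime] (hH : IsPGroup p (pResidual p G))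
    {A : Subrack ↥(pPowerElements p G)} (hA : A.IsFull) : A = ⊤ := by
  refine eq_top_of_isFull hA ?_
  by_contra hK
  rw [← Subgroup.subgroupOf_eq_top] at hK
  obtain ⟨M, hM, hle⟩ := (eq_top_or_exists_le_coatom _).resolve_left hK
  have hnil : Group.IsNilpotent (pResidual p G) := hH.isNilpotent
  have hn : M.Normal :=
    Subgroup.NormalizerCondition.normal_of_coatom M Group.normalizerCondition_of_isNilpotent hM
  have hV : pResidual p G ≤ M.map (pResidual p G).subtype := by
    refine (Subgroup.closure_le _).2 fun x hx => ?_
    obtain ⟨h, hh, hx'⟩ := isFull_iff.1 hA ⟨x, hx⟩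
    have hxH : x ∈ pResidual p G := Subgroup.subset_closure hx
    have h1 : (⟨h, hh⟩ * ⟨x, hxH⟩ * ⟨h, hh⟩⁻¹ : pResidual p G) ∈ M :=
      hle (Subgroup.mem_subgroupOf.2 (mem_groupClosure hx'))
    have h2 := hn.conj_mem _ h1 ⟨h, hh⟩⁻¹
    refine ⟨⟨x, hxH⟩, ?_, rfl⟩
    rwa [inv_inv, mul_assoc, mul_assoc, mul_assoc, inv_mul_cancel, mul_one,
      inv_mul_cancel_left] at h2
  refine hM.1 (top_le_iff.1 fun x _ => ?_)
  obtain ⟨y, hy, hyx⟩ := hV x.2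
  rwa [← Subtype.ext hyx]

/-- Sylow's theorem is applied inside `pResidual p G`, which contains `P`, because the conjugating
element must lie there. -/
theorem isFull_ofSubgroup_sylow [Fact p.Prime] (P : Sylow p G) :
    (ofSubgroup p (P : Subgroup G)).IsFull := by
  rw [isFull_iff]
  intro x
  have hP : (P : Subgroup G) ≤ pResidual p G := fun y hy =>
    Subgroup.subset_closure (mem_pPowerElements_of_isPGroup P.isPGroup' hy)
  have hxH : x.1 ∈ pResidual p G := Subgroup.subset_closure x.2
  have hx : IsPGroup p (Subgroup.zpowers (⟨x.1, hxH⟩ : pResidual p G)) := by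
    refine isPGroup_zpowers_of_mem_pPowerElements ?_
    obtain ⟨k, hk⟩ := x.2
    exact ⟨k, by rwa [Subgroup.orderOf_mk]⟩
  obtain ⟨S, hS⟩ := hx.exists_le_sylow
  obtain ⟨h, hh⟩ := MulAction.exists_smul_eq (pResidual p G) S (P.subtype hP)
  refine ⟨h, h.2, ?_⟩
  have h1 : (⟨x.1, hxH⟩ : pResidual p G) ∈ S := hS (Subgroup.mem_zpowers _)
  have h2 : h * ⟨x.1, hxH⟩ * h⁻¹ ∈ h • S := Subgroup.smul_mem_pointwise_smul _ _ _ h1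
  rw [hh] at h2
  exact h2

theorem pCore_eq_of_ofSubgroup_sylow_eq_top [Fact p.Prime] {P : Sylow p G}
    (hP : ofSubgroup p (P : Subgroup G) = ⊤) : (pCore p G : Set G) = pPowerElements p G := by
  have hV : ∀ x ∈ pPowerElements p G, x ∈ P := fun x hx => by
    have h : (⟨x, hx⟩ : ↥(pPowerElements p G)) ∈ ofSubgroup p (P : Subgroup G) := hP ▸ trivial
    exact h
  have hn : (P : Subgroup G).Normal := ⟨fun x hx g =>
    hV _ (conj_mem_pPowerElements g (mem_pPowerElements_of_isPGroup P.isPGroup' hx))⟩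
  refine Set.Subset.antisymm
    (fun x hx => mem_pPowerElements_of_isPGroup (isGreatest_pCore p G).1.2 hx) fun x hx => ?_
  exact (isGreatest_pCore p G).2 ⟨hn, P.isPGroup'⟩ (hV x hx)

theorem isPGroup_pResidual [Fact p.Prime] (h : (pCore p G : Set G) = pPowerElements p G) :
    IsPGroup p (pResidual p G) := by
  rw [pResidual, ← h, Subgroup.closure_eq]
  exact (isGreatest_pCore p G).1.2

/-- The identity is an orbit by itself, and Cauchy's theorem gives a second element. -/
theorem orbit_ne_univ (hp : p.Prime) (hpG : p ∣ Nat.card G) (x : ↥(pPowerElements p G)) :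
    MulAction.orbit (rackInn ↥(pPowerElements p G)) x ≠ Set.univ := by
  intro h
  have := Fact.mk hp
  obtain ⟨v, hv⟩ := exists_prime_orderOf_dvd_card' p hpG
  have h1 : (1 : G) ∈ pPowerElements p G := ⟨0, by simp⟩
  have hx : x.1 = 1 := by
    obtain ⟨g, hg⟩ : (⟨1, h1⟩ : ↥(pPowerElements p G)) ∈
        MulAction.orbit (rackInn ↥(pPowerElements p G)) x :=
      h.symm.subset trivial
    obtain ⟨k, -, hk⟩ := exists_mem_pResidual g
    have h2 := congrArg Subtype.val ((hk x).symm.trans hg)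
    rw [coe_smul] at h2
    simpa using h2
  obtain ⟨g, hg⟩ : (⟨v, 1, by rw [hv, pow_one]⟩ : ↥(pPowerElements p G)) ∈
    MulAction.orbit (rackInn ↥(pPowerElements p G)) x :=
      h.symm.subset trivial
  obtain ⟨k, -, hk⟩ := exists_mem_pResidual g
  have h2 := congrArg Subtype.val ((hk x).symm.trans hg)
  rw [coe_smul, hx] at h2
  have h3 : v = 1 := by simpa using h2.symm
  rw [h3, orderOf_one] at hv
  exact hp.one_lt.ne hv

theorem mem_parabolicSubracksOver_iff (hp : p.Prime) (hpG : p ∣ Nat.card G) {J : Subgroup G}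
    (hJ : IsPGroup p J) {A : Subrack ↥(pPowerElements p G)} :
    A ∈ parabolicSubracksOver p J ↔
      (A ∈ infPoset (Subrack ↥(pPowerElements p G)) ∧ A.IsFull) ∧ ∀ x, x.1 ∈ J → x ∈ A := by
  have := Fact.mk hp
  rw [← Subrack.mem_parabolicSubracks_iff (orbit_ne_univ hp hpG)]
  refine and_congr_right fun _ => ⟨fun h x hx => ?_, fun h x hx => ?_⟩
  · obtain ⟨y, hy, hyx⟩ := h hx
    rwa [← Subtype.ext hyx]
  · exact ⟨⟨x, mem_pPowerElements_of_isPGroup hJ hx⟩, h _ hx, rfl⟩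

/-- A coatom above a Sylow subgroup containing `J` is full and is the meet of itself alone. -/
theorem nonempty_parabolicSubracksOver (hp : p.Prime) (hpG : p ∣ Nat.card G) {J : Subgroup G}
    (hJ : IsPGroup p J) (hcore : (pCore p G : Set G) ≠ pPowerElements p G) :
    (parabolicSubracksOver p J).Nonempty := by
  have := Fact.mk hp
  obtain ⟨P, hJP⟩ := hJ.exists_le_sylow
  have hP : ofSubgroup p (P : Subgroup G) ≠ ⊤ := fun h =>
    hcore (pCore_eq_of_ofSubgroup_sylow_eq_top h)
  obtain ⟨M, hM, hle⟩ := (eq_top_or_exists_le_coatom _).resolve_left hP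
  have hMfull : M.IsFull := (isFull_ofSubgroup_sylow P).mono hle
  have : Nonempty ↥(pPowerElements p G) := ⟨1, 0, by simp⟩
  exact ⟨M, (mem_parabolicSubracksOver_iff hp hpG hJ).2 ⟨⟨⟨⟨hMfull.ne_bot, hM.1⟩, {M},
    fun c hc => Set.mem_singleton_iff.1 hc ▸ hM, sInf_singleton.symm⟩, hMfull⟩,
    fun x hx => hle (hJP hx)⟩⟩

open scoped Classical in
theorem chainSum_fixed_eq_zero [Fintype (Subrack ↥(pPowerElements p G))] (hp : p.Prime)
    (hpG : p ∣ Nat.card G) {J : Subgroup G} (hJ : IsPGroup p J)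
    {S₀ : Subrack ↥(pPowerElements p G)} (hS₀ : IsLeast (parabolicSubracksOver p J) S₀) :
    chainSum {A : Subrack ↥(pPowerElements p G) |
      (A.IsFull ∧ A ≠ ⊤) ∧ ∀ g ∈ J, g • A = A} = 0 := by
  have := Fact.mk hp
  have : Nonempty ↥(pPowerElements p G) := ⟨1, 0, by simp⟩
  have hstab : ∀ A : Subrack ↥(pPowerElements p G), (∀ x, x.1 ∈ J → x ∈ A) →
      ∀ g ∈ J, g • A = A := by
    have hle : ∀ A : Subrack ↥(pPowerElements p G), (∀ x, x.1 ∈ J → x ∈ A) →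
        ∀ g ∈ J, ∀ x ∈ A, g • x ∈ A := fun A hA g hg x hx =>
      A.act_mem (hA ⟨g, mem_pPowerElements_of_isPGroup hJ hg⟩ hg) hx
    intro A hA g hg
    refine SetLike.ext fun x => ?_
    rw [Subrack.mem_smul_iff]
    refine ⟨fun hx => ?_, fun hx => hle A hA _ (inv_mem hg) _ hx⟩
    simpa using hle A hA g hg _ hx
  -- The closure operator. On all subracks it may take the value `⊤`, as an empty meet;
  -- `exists_coatom` excludes this for proper full `J`-stable arguments.
  let f : Subrack ↥(pPowerElements p G) → Subrack ↥(pPowerElements p G) := fun A =>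
    sInf {M | IsCoatom M ∧ A ≤ M ∧ ∀ x, x.1 ∈ J → x ∈ M}
  have hle : ∀ A, A ≤ f A := fun A => le_sInf fun M hM => hM.2.1
  have hJf : ∀ A x, x.1 ∈ J → x ∈ f A := fun A x hx M hM => hM.2.2 x hx
  have hfle : ∀ A M, IsCoatom M → A ≤ M → (∀ x, x.1 ∈ J → x ∈ M) → f A ≤ M :=
    fun A M h1 h2 h3 => sInf_le ⟨h1, h2, h3⟩
  have hf_ne_top : ∀ A : Subrack ↥(pPowerElements p G), A.IsFull → A ≠ ⊤ →
      (∀ g ∈ J, g • A = A) → f A ≠ ⊤ := by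
    intro A h1 h2 h3
    obtain ⟨M, hM, hAM, hJM⟩ := exists_coatom h1 h2 h3
    exact ((hfle A M hM hAM hJM).trans_lt (lt_top_iff_ne_top.2 hM.1)).ne
  rw [chainSum_eq_of_closure f (fun A B h => le_sInf fun M hM => hfle A M hM.1 (h.trans hM.2.1)
    hM.2.2) hle fun A => le_antisymm (le_sInf fun M hM =>
      hfle _ M hM.1 (hfle A M hM.1 hM.2.1 hM.2.2) hM.2.2) (hle _)]
  · obtain ⟨hS₀, hmin⟩ := hS₀
    obtain ⟨⟨⟨⟨-, htop⟩, C, hC, hSC⟩, hfull⟩, hJS⟩ :=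
      (mem_parabolicSubracksOver_iff hp hpG hJ).1 hS₀
    refine chainSum_eq_zero_of_isLeast (a := S₀) _ ⟨?_, fun A hA => ?_⟩
    · simp only [Finset.coe_filter, Finset.mem_filter, Finset.mem_univ, true_and,
        Set.mem_ofPred_eq]
      -- `S₀` is closed: every coatom in a family with meet `S₀` contains both `S₀` and `J`, so it
      -- takes part in the meet `f S₀`.
      refine ⟨⟨⟨hfull, htop⟩, hstab S₀ hJS⟩, le_antisymm ?_ (hle _)⟩
      refine (le_sInf fun M hM => ?_).trans hSC.ge
      have hSM : S₀ ≤ M := hSC.le.trans (sInf_le hM)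
      exact hfle _ M (hC M hM) hSM fun x hx => hSM (hJS x hx)
    · simp only [Finset.coe_filter, Finset.mem_filter, Finset.mem_univ, true_and,
        Set.mem_ofPred_eq] at hA
      refine hmin ((mem_parabolicSubracksOver_iff hp hpG hJ).2
        ⟨⟨⟨⟨hA.1.1.1.ne_bot, hA.1.1.2⟩, _, fun c hc => hc.1, hA.2.symm⟩, hA.1.1.1⟩, ?_⟩)
      exact fun x hx => hA.2 ▸ hJf A x hx
  · intro A hA
    simp only [Finset.mem_filter, Finset.mem_univ, true_and] at hA ⊢
    exact ⟨⟨hA.1.1.mono (hle A), hf_ne_top A hA.1.1 hA.1.2 hA.2⟩, hstab _ (hJf A)⟩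

end pPowerRack

theorem mainTheorem1 (G : Type*) [Group G] [Finite G] (p : ℕ) (hp : p.Prime)
    (hpG : p ∣ Nat.card G)
    (hmin : ∀ J : Subgroup G, IsPGroup p J → J ≠ ⊥ → (parabolicSubracksOver p J).Nonempty →
      ∃ S₀, IsLeast (parabolicSubracksOver p J) S₀) :
    ((p ^ (Nat.card G).factorization p : ℕ) : ℤ) ∣
        reducedEulerChar (orderComplex ↥(properPart (Subrack ↥(pPowerElements p G)))) ↔
      (pCore p G : Set G) ≠ pPowerElements p G := by
  classical
  have := Fact.mk hp
  have : Nonempty ↥(pPowerElements p G) := ⟨1, 0, by simp⟩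
  have : Fintype (Subrack ↥(pPowerElements p G)) := Fintype.ofFinite _
  have : Fintype (MulAction.orbitRel.Quotient (rackInn ↥(pPowerElements p G))
      ↥(pPowerElements p G)) := Fintype.ofFinite _
  rw [Subrack.reducedEulerChar_properPart]
  constructor
  · intro hdvd hcore
    -- No proper subrack is full, so only the empty chain is counted and the Euler characteristic is
    -- a power of `-1`.
    rw [Finset.filter_false_of_mem fun A _ h => h.2
      (pPowerRack.eq_top_of_isFull_of_isPGroup (pPowerRack.isPGroup_pResidual hcore) h.1),
      chainSum_empty, mul_one] at hdvd
    have hunit : IsUnit ((p ^ (Nat.card G).factorization p : ℕ) : ℤ) :=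
      isUnit_of_dvd_unit hdvd (isUnit_one.neg.pow _)
    rw [Int.isUnit_iff_natAbs_eq, Int.natAbs_natCast, Nat.pow_eq_one] at hunit
    rcases hunit with h | h
    · exact hp.one_lt.ne' h
    · exact (hp.factorization_pos_of_dvd Nat.card_pos.ne' hpG).ne' h
  · intro hcore
    let P : Sylow p G := default
    refine Dvd.dvd.mul_left ?_ _
    rw [← P.card_eq_multiplicity]
    refine card_dvd_chainSum_of_fixed (Q := (P : Subgroup G))
      (fun g A B h => Subrack.smul_mono (g : G) h) _ (fun g A hA => ?_) fun J hJ => ?_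
    · simp only [Finset.mem_filter, Finset.mem_univ, true_and] at hA ⊢
      refine ⟨pPowerRack.isFull_smul (g : G) hA.1, fun h => hA.2 ?_⟩
      rw [← inv_smul_smul g A, h]
      rfl
    -- `J` is a subgroup of `P`; the hypothesis concerns its image in `G`.
    · have hJ' : IsPGroup p (J.map (P : Subgroup G).subtype) :=
        P.isPGroup'.to_le (Subgroup.map_subtype_le J)
      obtain ⟨S₀, hS₀⟩ := hmin _ hJ'
        (fun h => hJ ((Subgroup.map_eq_bot_iff_of_injective J Subtype.val_injective).1 h))
        (pPowerRack.nonempty_parabolicSubracksOver hp hpG hJ' hcore)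
      rw [← pPowerRack.chainSum_fixed_eq_zero hp hpG hJ' hS₀, Finset.filter_filter]
      congr 1
      ext A
      simp only [Finset.mem_filter, Finset.mem_univ, true_and]
      refine and_congr_right fun _ => ⟨?_, fun h g hg => h g (Subgroup.mem_map_of_mem _ hg)⟩
      rintro h _ ⟨g, hg, rfl⟩
      exact h g hg
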